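/- Let $Y_1,Y_2,\dots$ and $Y$ be real-valued random variables such that $Y_n$ converges in distribution to $Y$. A point process on $\mathbb{R}$ is a random element of the space of Borel measures on $\mathbb{R}$ that take values in $\{0,1,2,\dots\}$ on every bounded Borel set, equipped with the $\sigma$-algebra generated by the evaluations $\mu\mapsto\mu(B)$, $B$ Borel, and with the vague topology (the coarsest one making $\mu\mapsto\int f\,d\mu$ continuous for every continuous compactly supported $f:\mathbb{R}\to\mathbb{R}$). Convergence in distribution of point processes means weak convergence of their laws with respect to the vague topology. For every $n$, let $N_n$ be a point process on $\mathbb{R}$ defined on the same probability space as $Y_n$ (this space may depend on $n$). Let $N$ be a point process on $\mathbb{R}$, defined on the same probability space as $Y$ and independent of $Y$, which is simple, i.e. almost surely $N(\{x\})\le 1$ for all $x\in\mathbb{R}$, and which satisfies $\mathbb{E}[N(I)]<\infty$ for every bounded interval $I$. Suppose that (K1) $\limsup_{n\to\infty}\mathbb{E}[N_n(I)]\le\mathbb{E}[N(I)]$ for every interval $I\subseteq\mathbb{R}$; (K2) $\lim_{n\to\infty}\mathbb{P}(Y_n\le y,\ N_n(U)=0)=\mathbb{P}(Y\le y)\,\mathbb{P}(N(U)=0)$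 for every $y\in\mathbb{R}$ and every finite union $U\subseteq\mathbb{R}$ of intervals. Then $N_n$ converges in distribution to $N$, and $(Y_n)$ and $(N_n)$ are asymptotically independent: for every $y\in\mathbb{R}$, all bounded Borel sets $B_1,\dots,B_k$ with $N(\partial B_i)=0$ almost surely for $i=1,\dots,k$, and all $l_1,\dots,l_k\in\{0,1,2,\dots\}$, $$\lim_{n\to\infty}\mathbb{P}\big(Y_n\le y,\ N_n(B_1)\le l_1,\dots,N_n(B_k)\le l_k\big)=\mathbb{P}(Y\le y)\,\mathbb{P}\big(N(B_1)\le l_1,\dots,N(B_k)\le l_k\big).$$ -/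

import Mathlib

open MeasureTheory ProbabilityTheory Filter Topology
open scoped ENNReal CompactlySupported

/-- Locally finite point measures on `ℝ`: Borel measures taking a value in `ℕ = {0, 1, 2, …}` on every
bounded Borel set. -/
@[ext]
structure PointMeasure where
  toMeasure : Measure ℝ
  exists_nat_eq : ∀ B : Set ℝ, MeasurableSet B → Bornology.IsBounded B →
    ∃ k : ℕ, toMeasure B = (k : ℝ≥0∞)

namespace PointMeasure

/-- The σ-algebra generated by the evaluations `μ ↦ μ B`, `B` Borel (this is what the σ-algebra of
`Measure ℝ` is generated by). -/
instance instMeasurableSpace : MeasurableSpace PointMeasure :=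
  MeasurableSpace.comap PointMeasure.toMeasure inferInstance

/-- The vague topology: the coarsest topology for which `μ ↦ ∫ f dμ` is continuous for every
continuous compactly supported `f : ℝ → ℝ`. -/
noncomputable instance instTopologicalSpace : TopologicalSpace PointMeasure :=
  TopologicalSpace.induced
    (fun (μ : PointMeasure) (f : C_c(ℝ, ℝ)) => ∫ x, f x ∂μ.toMeasure) inferInstance

theorem measurable_toMeasure : Measurable PointMeasure.toMeasure :=
  comap_measurable _

instance instIsLocallyFiniteMeasure (μ : PointMeasure) : IsLocallyFiniteMeasure μ.toMeasure := by
  refine ⟨fun x => ⟨Metric.ball x 1, Metric.ball_mem_nhds x one_pos, ?_⟩⟩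
  obtain ⟨k, hk⟩ := μ.exists_nat_eq _ measurableSet_ball (Metric.isBounded_ball (x := x) (r := 1))
  rw [hk]
  exact ENNReal.natCast_lt_top k

theorem integrable_compactlySupported (μ : PointMeasure) (f : C_c(ℝ, ℝ)) :
    Integrable (fun x => f x) μ.toMeasure :=
  f.continuous.integrable_of_hasCompactSupport f.hasCompactSupport

theorem measurable_integral_compactlySupported (f : C_c(ℝ, ℝ)) :
    Measurable (fun μ : PointMeasure => ∫ x, f x ∂μ.toMeasure) := by
  have h : (fun μ : PointMeasure => ∫ x, f x ∂μ.toMeasure) = fun μ : PointMeasure =>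
      (∫⁻ x, ENNReal.ofReal (f x) ∂μ.toMeasure).toReal
        - (∫⁻ x, ENNReal.ofReal (-f x) ∂μ.toMeasure).toReal := by
    funext μ
    exact integral_eq_lintegral_pos_part_sub_lintegral_neg_part
      (μ.integrable_compactlySupported f)
  rw [h]
  have hf : Measurable (fun x => f x) := f.continuous.measurable
  exact (((Measure.measurable_lintegral hf.ennreal_ofReal).comp
      measurable_toMeasure).ennreal_toReal).sub
    (((Measure.measurable_lintegral hf.neg.ennreal_ofReal).comp
      measurable_toMeasure).ennreal_toReal)

/-- A countable family of test functions that approximates every test function. -/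
theorem exists_countable_testFunctions : ∃ C : Set C_c(ℝ, ℝ), C.Countable ∧
    ∀ f : C_c(ℝ, ℝ), ∃ h ∈ C, ∀ ε > (0 : ℝ), ∃ g ∈ C, ∀ x, |g x - f x| ≤ ε * h x := by
  classical
  let A : ℕ → Set C(ℝ, ℝ) := fun m => {g | ∀ x ∉ Set.Icc (-(m : ℝ)) m, g x = 0}
  let toC : ∀ m, A m → C_c(ℝ, ℝ) := fun m g =>
    ⟨g.1, HasCompactSupport.intro isCompact_Icc g.2⟩
  choose D hDc hDd using fun m => TopologicalSpace.exists_countable_dense (A m)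
  let H : ℕ → C_c(ℝ, ℝ) := fun m =>
    ⟨⟨fun x => max 0 (min 1 ((m : ℝ) + 1 - |x|)), by fun_prop⟩,
      HasCompactSupport.intro (isCompact_Icc (a := -((m : ℝ) + 1)) (b := (m : ℝ) + 1)) (by
        intro x hx
        have hx' : (m : ℝ) + 1 < |x| := by
          by_contra hc
          exact hx (abs_le.mp (not_lt.mp hc))
        show max 0 (min 1 ((m : ℝ) + 1 - |x|)) = 0
        exact max_eq_left ((min_le_right _ _).trans (by linarith)))⟩
  refine ⟨(⋃ m, toC m '' D m) ∪ Set.range H,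
    (Set.countable_iUnion fun m => (hDc m).image _).union (Set.countable_range H), fun f => ?_⟩
  obtain ⟨r, hr⟩ := f.hasCompactSupport.isBounded.subset_closedBall 0
  obtain ⟨m, hm⟩ := exists_nat_ge r
  have hfA : f.toContinuousMap ∈ A m := by
    intro x hx
    by_contra hne
    have h1 : x ∈ Metric.closedBall (0 : ℝ) r := hr (subset_tsupport _ hne)
    rw [Metric.mem_closedBall, dist_zero_right, Real.norm_eq_abs] at h1
    exact hx (abs_le.mp (h1.trans hm))
  refine ⟨H m, Or.inr ⟨m, rfl⟩, fun ε hε => ?_⟩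
  have hopen : IsOpen {g : A m | ∀ x ∈ Set.Icc (-(m : ℝ)) m, |g.1 x - f x| < ε} := by
    have h1 : {g : A m | ∀ x ∈ Set.Icc (-(m : ℝ)) m, |g.1 x - f x| < ε}
        = (fun g : A m => g.1 - f.toContinuousMap) ⁻¹'
          {k : C(ℝ, ℝ) | Set.MapsTo k (Set.Icc (-(m : ℝ)) m) (Metric.ball 0 ε)} := by
      ext g
      simp [Set.MapsTo]
    rw [h1]
    exact (ContinuousMap.isOpen_setOfPred_mapsTo isCompact_Icc Metric.isOpen_ball).preimage
      (by fun_prop)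
  obtain ⟨g, hg, hgD⟩ := (hDd m).exists_mem_open hopen
    ⟨⟨f.toContinuousMap, hfA⟩, fun x _ => by simpa using hε⟩
  refine ⟨toC m g, Or.inl (Set.mem_iUnion.mpr ⟨m, g, hg, rfl⟩), fun x => ?_⟩
  show |g.1 x - f x| ≤ ε * max 0 (min 1 ((m : ℝ) + 1 - |x|))
  by_cases hx : x ∈ Set.Icc (-(m : ℝ)) m
  · have h2 : |x| ≤ m := abs_le.mpr hx
    rw [min_eq_left (by linarith), max_eq_right zero_le_one, mul_one]
    exact (hgD x hx).le
  · have h3 : f x = 0 := hfA x hx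
    rw [g.2 x hx, h3, sub_zero, abs_zero]
    positivity

/-- Vaguely open sets are measurable, so that convergence in distribution makes sense. -/
instance instOpensMeasurableSpace : OpensMeasurableSpace PointMeasure := by
  obtain ⟨C, hC, happ⟩ := exists_countable_testFunctions
  have : Countable C := hC.to_subtype
  let Φ : PointMeasure → (C → ℝ) := fun μ f => ∫ x, f.1 x ∂μ.toMeasure
  have hΦ : Measurable Φ :=
    measurable_pi_lambda _ fun f => measurable_integral_compactlySupported f.1
  let t : TopologicalSpace PointMeasure := TopologicalSpace.induced Φ inferInstance
  have hle : t ≤ instTopologicalSpace := by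
    refine continuous_iff_le_induced.mp ?_
    refine continuous_pi fun f => ?_
    have hcont : ∀ g ∈ C, Continuous[t, _] (fun μ : PointMeasure => ∫ x, g x ∂μ.toMeasure) :=
      fun g hg => by
        have h1 : Continuous[t, _] Φ := continuous_induced_dom
        have h2 : Continuous (fun p : C → ℝ => p ⟨g, hg⟩) := continuous_apply _
        exact @Continuous.comp _ _ _ t _ _ _ _ h2 h1
    obtain ⟨h, hh, happ⟩ := happ f
    have key : ∀ ε > (0 : ℝ), ∀ g : C_c(ℝ, ℝ), (∀ x, |g x - f x| ≤ ε * h x) →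
        ∀ μ : PointMeasure, |∫ x, g x ∂μ.toMeasure - ∫ x, f x ∂μ.toMeasure|
          ≤ ε * ∫ x, h x ∂μ.toMeasure := by
      intro ε _ g hg μ
      rw [← integral_sub (μ.integrable_compactlySupported g) (μ.integrable_compactlySupported f),
        ← integral_const_mul]
      refine (abs_integral_le_integral_abs).trans (integral_mono ?_ ?_ hg)
      · exact ((μ.integrable_compactlySupported g).sub (μ.integrable_compactlySupported f)).abs
      · exact (μ.integrable_compactlySupported h).const_mul ε
    rw [continuous_iff_continuousAt]
    intro μ₀
    rw [ContinuousAt, Metric.tendsto_nhds]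
    intro δ hδ
    set M : ℝ := |∫ x, h x ∂μ₀.toMeasure| + 1 with hM
    have hMpos : 0 < M := by positivity
    obtain ⟨g, hg, hgf⟩ := happ (δ / (3 * M)) (by positivity)
    have e1 : ∀ᶠ μ in @nhds _ t μ₀, ∫ x, h x ∂μ.toMeasure < M :=
      ((hcont h hh).tendsto μ₀).eventually_lt_const
        (lt_of_le_of_lt (le_abs_self _) (lt_add_one _))
    have e2 : ∀ᶠ μ in @nhds _ t μ₀,
        dist (∫ x, g x ∂μ.toMeasure) (∫ x, g x ∂μ₀.toMeasure) < δ / 3 :=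
      Metric.tendsto_nhds.mp ((hcont g hg).tendsto μ₀) (δ / 3) (by positivity)
    filter_upwards [e1, e2] with μ h1 h2
    have b : ∀ I : ℝ, I ≤ M → δ / (3 * M) * I ≤ δ / 3 := by
      intro I hI
      calc δ / (3 * M) * I ≤ δ / (3 * M) * M := by gcongr
        _ = δ / 3 := by field_simp
    have h3 := (key _ (by positivity) g hgf μ).trans (b _ h1.le)
    have h4 := (key _ (by positivity) g hgf μ₀).trans
      (b _ ((le_abs_self _).trans (lt_add_one _).le))
    rw [Real.dist_eq] at h2 ⊢
    rw [abs_lt] at h2 ⊢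
    rw [abs_le] at h3 h4
    constructor <;> linarith [h3.1, h3.2, h4.1, h4.2, h2.1, h2.2]
  refine @OpensMeasurableSpace.mk _ instTopologicalSpace _
    (MeasurableSpace.generateFrom_le fun s hs => ?_)
  obtain ⟨V, hV, rfl⟩ := hle s hs
  exact hΦ hV.measurableSet

/-- A point measure is simple if it has no multiple points. -/
def IsSimple (μ : PointMeasure) : Prop :=
  ∀ x : ℝ, μ.toMeasure {x} ≤ 1

end PointMeasure

/-- Finite unions of intervals. The intervals of `ℝ` are its order-connected subsets. -/
def IsFiniteUnionOfIntervals (U : Set ℝ) : Prop :=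
  ∃ S : Set (Set ℝ), S.Finite ∧ (∀ I ∈ S, I.OrdConnected) ∧ U = ⋃₀ S

/-- Bounded Borel sets `B` whose boundary is almost surely not charged by the point process `N`. -/
def IsContinuitySet {Ω : Type*} [MeasurableSpace Ω] (P : Measure Ω) (N : Ω → PointMeasure)
    (B : Set ℝ) : Prop :=
  MeasurableSet B ∧ Bornology.IsBounded B ∧ ∀ᵐ ω ∂P, (N ω).toMeasure (frontier B) = 0

/-- Asymptotic independence of a sequence of random variables `Yn` with limit `Y` in distribution
and a sequence of point processes `Nn` with limit `N` in distribution. -/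
structure AsymptoticallyIndependent {Ωn : ℕ → Type*} [∀ n, MeasurableSpace (Ωn n)]
    (Pn : ∀ n, Measure (Ωn n)) [∀ n, IsProbabilityMeasure (Pn n)]
    {Ω : Type*} [MeasurableSpace Ω] (P : Measure Ω) [IsProbabilityMeasure P]
    (Yn : ∀ n, Ωn n → ℝ) (Y : Ω → ℝ)
    (Nn : ∀ n, Ωn n → PointMeasure) (N : Ω → PointMeasure) : Prop where
  tendsto_variables : TendstoInDistribution Yn atTop Y Pn P
  tendsto_processes : TendstoInDistribution Nn atTop N Pn P
  tendsto_joint : ∀ (y : ℝ) (k : ℕ) (B : Fin k → Set ℝ) (l : Fin k → ℕ),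
    (∀ i, IsContinuitySet P N (B i)) →
    Tendsto (fun n => Pn n {ω | Yn n ω ≤ y ∧ ∀ i, (Nn n ω).toMeasure (B i) ≤ (l i : ℝ≥0∞)})
      atTop
      (𝓝 (P {ω | Y ω ≤ y} * P {ω | ∀ i, (N ω).toMeasure (B i) ≤ (l i : ℝ≥0∞)}))

/-!
A point process is observed through uniform grids of half-open cells. Whether a finite union of
cells is charged is an event whose limiting probability is an avoidance probability, so
inclusion–exclusion over the finitely many cells of a window turns the convergence of the avoidance
functions into convergence of the law of the set of occupied cells
(`PointMeasure.AvoidanceTendsto.tendsto_occupied`). The occupied cells determine the point measure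
on the grid unless some cell has two points. By
`P(Nₙ(I) ≥ 2) ≤ E[Nₙ(I)] - P(Nₙ(I) ≠ 0)` and the bound on the means, the limiting probability of
that event is at most `∑ E[(N(I) - 1)⁺]` over the cells `I`
(`PointMeasure.eventually_measure_badEvent_le`), which tends to zero with the mesh because `N` is
simple (`PointMeasure.tendsto_lintegral_excess`). Therefore an event that is determined by the
occupied cells, up to cells with several points and up to cells covering a set `F` that `N` does
not charge, has almost the same probability under both laws
(`PointMeasure.eventually_measure_le_of_occupied`).

This is applied twice. With `F` the union of the frontiers of the sets `Bᵢ` it gives the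
convergence of the counts, since a cell that misses the frontier of `Bᵢ` lies inside or outside
`Bᵢ` (`PointMeasure.tendsto_measure_counts_le`). With `F = ∅` it gives weak convergence through the
portmanteau theorem: a vaguely open set is the increasing union of events determined by the counts
on fine grids of large windows (`PointMeasure.exists_forall_sameCounts_mem`,
`PointMeasure.measure_le_liminf_of_isOpen`).

All this is done for laws `Pₙ`, `P` on the space of point measures and smaller measures `Qₙ`, `Q`.
The variable `Yₙ` enters only through the choice of `Qₙ` as the law of `Nₙ` restricted to `Yₙ ≤ y`,
whose limit is `Q = P(Y ≤ y) • P`.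
-/

/-! ### Uniform grids on the line -/

/-- The `j`-th half-open cell of the uniform grid of mesh `1 / (m + 1)`. -/
def gridCell (m : ℕ) (j : ℤ) : Set ℝ := Set.Ioc ((j : ℝ) / (m + 1)) (((j : ℝ) + 1) / (m + 1))

/-- The indices of the cells of mesh `1 / (m + 1)` that partition the window `(-K, K]`. -/
noncomputable def gridIndex (K m : ℕ) : Finset ℤ := Finset.Ico (-((K : ℤ) * (m + 1))) ((K : ℤ) * (m + 1))

theorem mem_gridCell {m : ℕ} {j : ℤ} {x : ℝ} :
    x ∈ gridCell m j ↔ (j : ℝ) < x * (m + 1) ∧ x * (m + 1) ≤ j + 1 := by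
  have h : (0 : ℝ) < m + 1 := by positivity
  rw [gridCell, Set.mem_Ioc, div_lt_iff₀ h, le_div_iff₀ h]

theorem ordConnected_gridCell (m : ℕ) (j : ℤ) : (gridCell m j).OrdConnected := Set.ordConnected_Ioc

theorem measurableSet_gridCell (m : ℕ) (j : ℤ) : MeasurableSet (gridCell m j) := measurableSet_Ioc

theorem isBounded_gridCell (m : ℕ) (j : ℤ) : Bornology.IsBounded (gridCell m j) :=
  Metric.isBounded_Ioc _ _

theorem pairwiseDisjoint_gridCell (m : ℕ) (s : Set ℤ) : s.PairwiseDisjoint (gridCell m) := by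
  intro i _ j _ hij
  refine Set.disjoint_left.mpr fun x hx hx' => hij ?_
  rw [mem_gridCell] at hx hx'
  have h1 : i < j + 1 := by exact_mod_cast hx.1.trans_le hx'.2
  have h2 : j < i + 1 := by exact_mod_cast hx'.1.trans_le hx.2
  omega

theorem abs_sub_le_of_mem_gridCell {m : ℕ} {j : ℤ} {x y : ℝ} (hx : x ∈ gridCell m j)
    (hy : y ∈ gridCell m j) : |x - y| ≤ 1 / ((m : ℝ) + 1) := by
  have h : (0 : ℝ) < m + 1 := by positivity
  rw [le_div_iff₀ h]
  nth_rewrite 1 [← abs_of_pos h]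
  rw [← abs_mul, abs_le]
  rw [mem_gridCell] at hx hy
  constructor <;> linarith [hx.1, hx.2, hy.1, hy.2]

theorem nonempty_gridCell (m : ℕ) (j : ℤ) : (gridCell m j).Nonempty :=
  Set.nonempty_Ioc.mpr (by gcongr; linarith)

theorem biUnion_gridCell (K m : ℕ) : ⋃ j ∈ gridIndex K m, gridCell m j = Set.Ioc (-(K : ℝ)) K := by
  have h : (0 : ℝ) < m + 1 := by positivity
  ext x
  simp only [Set.mem_iUnion, exists_prop, gridIndex, Finset.mem_Ico, mem_gridCell, Set.mem_Ioc]
  constructor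
  · rintro ⟨j, ⟨h1, h2⟩, h3, h4⟩
    have h1' : -((K : ℝ) * (m + 1)) ≤ j := by exact_mod_cast h1
    have h2' : (j : ℝ) + 1 ≤ (K : ℝ) * (m + 1) := by exact_mod_cast h2
    constructor <;> nlinarith
  · rintro ⟨h1, h2⟩
    have h5 := Int.ceil_lt_add_one (x * (m + 1))
    have h6 := Int.le_ceil (x * (m + 1))
    refine ⟨⌈x * (m + 1)⌉ - 1, ⟨?_, ?_⟩, ?_, ?_⟩
    · have : -((K : ℤ) * (m + 1)) < ⌈x * (m + 1)⌉ := by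
        rw [Int.lt_ceil]
        push_cast
        nlinarith
      omega
    · have : ⌈x * (m + 1)⌉ ≤ (K : ℤ) * (m + 1) := by
        rw [Int.ceil_le]
        push_cast
        nlinarith
      omega
    · push_cast
      linarith
    · push_cast
      linarith

theorem gridIndex_mono {K L : ℕ} (h : K ≤ L) (m : ℕ) : gridIndex K m ⊆ gridIndex L m := by
  have : (K : ℤ) * (m + 1) ≤ (L : ℤ) * (m + 1) := by gcongr
  exact Finset.Ico_subset_Ico (by linarith) this

theorem gridCell_subset_window {K m : ℕ} {j : ℤ} (hj : j ∈ gridIndex K m) :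
    gridCell m j ⊆ Set.Ioc (-(K : ℝ)) K := by
  rw [← biUnion_gridCell K m]
  exact Set.subset_biUnion_of_mem (u := gridCell m) hj

theorem measure_eq_sum_inter_gridCell (ν : Measure ℝ) {K : ℕ} (m : ℕ) {B : Set ℝ}
    (hB : MeasurableSet B) (hBK : B ⊆ Set.Ioc (-(K : ℝ)) K) :
    ν B = ∑ j ∈ gridIndex K m, ν (B ∩ gridCell m j) := by
  rw [← measure_biUnion_finset, ← Set.inter_iUnion₂, biUnion_gridCell, Set.inter_eq_left.mpr hBK]
  · exact fun i hi j hj hij => ((pairwiseDisjoint_gridCell m Set.univ) trivial trivial hij).mono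
      Set.inter_subset_right Set.inter_subset_right
  · exact fun j _ => hB.inter (measurableSet_gridCell m j)

/-- A cell that does not meet the frontier of `B` lies inside `B` or outside `B`, because it is
connected. -/
theorem subset_or_disjoint_of_disjoint_frontier {m : ℕ} {j : ℤ} {B : Set ℝ}
    (h : Disjoint (gridCell m j) (frontier B)) : gridCell m j ⊆ B ∨ Disjoint (gridCell m j) B := by
  have hcov : gridCell m j ⊆ interior B ∪ (closure B)ᶜ := by
    intro x hx
    by_contra hc
    simp only [Set.mem_union, Set.mem_compl_iff, not_or, not_not] at hc
    exact Set.disjoint_left.mp h hx ⟨hc.2, hc.1⟩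
  have hdisj : Disjoint (interior B) (closure B)ᶜ :=
    Set.disjoint_compl_right_iff_subset.mpr (interior_subset.trans subset_closure)
  rcases isPreconnected_Ioc.subset_or_subset isOpen_interior isClosed_closure.isOpen_compl
    hdisj hcov with h1 | h1
  · exact Or.inl (h1.trans interior_subset)
  · exact Or.inr (Set.disjoint_left.mpr fun x hx hxB => h1 hx (subset_closure hxB))

namespace PointMeasure

variable (μ : PointMeasure)

theorem measure_lt_top {B : Set ℝ} (hB : Bornology.IsBounded B) : μ.toMeasure B < ∞ :=
  hB.measure_lt_top

theorem measurable_apply {B : Set ℝ} (hB : MeasurableSet B) :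
    Measurable fun μ : PointMeasure => μ.toMeasure B :=
  (Measure.measurable_coe hB).comp measurable_toMeasure

theorem one_le_measure {B : Set ℝ} (hB : MeasurableSet B) (hb : Bornology.IsBounded B)
    (h : μ.toMeasure B ≠ 0) : 1 ≤ μ.toMeasure B := by
  obtain ⟨k, hk⟩ := μ.exists_nat_eq B hB hb
  rw [hk] at h ⊢
  exact_mod_cast Nat.one_le_iff_ne_zero.mpr (by exact_mod_cast h)

theorem two_le_measure {B : Set ℝ} (hB : MeasurableSet B) (hb : Bornology.IsBounded B)
    (h : 1 < μ.toMeasure B) : 2 ≤ μ.toMeasure B := by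
  obtain ⟨k, hk⟩ := μ.exists_nat_eq B hB hb
  rw [hk] at h ⊢
  exact_mod_cast (show 1 < k by exact_mod_cast h)

end PointMeasure

/-! ### Avoidance functions and occupied cells -/

namespace PointMeasure

/-- The avoidance functions `U ↦ Qₙ (μ U = 0)` converge to the one of `Q` on finite unions of
intervals. -/
def AvoidanceTendsto (Qn : ℕ → Measure PointMeasure) (Q : Measure PointMeasure) : Prop :=
  ∀ U : Set ℝ, IsFiniteUnionOfIntervals U →
    Tendsto (fun n => Qn n {μ | μ.toMeasure U = 0}) atTop (𝓝 (Q {μ | μ.toMeasure U = 0}))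

theorem measurableSet_measure_eq_zero {B : Set ℝ} (hB : MeasurableSet B) :
    MeasurableSet {μ : PointMeasure | μ.toMeasure B = 0} :=
  measurable_apply hB (measurableSet_singleton 0)

variable {Qn Pn : ℕ → Measure PointMeasure} {Q P : Measure PointMeasure}

/-- Inclusion–exclusion, organized as an induction on the set `B` of intervals that are hit. -/
theorem AvoidanceTendsto.tendsto_avoid_hit [∀ n, IsFiniteMeasure (Qn n)] [IsFiniteMeasure Q]
    (h : AvoidanceTendsto Qn Q) {I : ℤ → Set ℝ} (hI : ∀ j, (I j).OrdConnected) (B : Finset ℤ) :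
    ∀ A : Finset ℤ, Tendsto (fun n => Qn n {μ : PointMeasure | (∀ j ∈ A, μ.toMeasure (I j) = 0) ∧
        ∀ j ∈ B, μ.toMeasure (I j) ≠ 0}) atTop
      (𝓝 (Q {μ : PointMeasure | (∀ j ∈ A, μ.toMeasure (I j) = 0) ∧ ∀ j ∈ B, μ.toMeasure (I j) ≠ 0})) := by
  classical
  induction B using Finset.induction_on with
  | empty =>
    intro A
    have hU : IsFiniteUnionOfIntervals (⋃ j ∈ A, I j) :=
      ⟨I '' A, A.finite_toSet.image I, by rintro _ ⟨j, _, rfl⟩; exact hI j, by simp⟩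
    have hset : {μ : PointMeasure | (∀ j ∈ A, μ.toMeasure (I j) = 0) ∧
        ∀ j ∈ (∅ : Finset ℤ), μ.toMeasure (I j) ≠ 0}
        = {μ : PointMeasure | μ.toMeasure (⋃ j ∈ A, I j) = 0} := by
      ext μ
      simp
    rw [hset]
    exact h _ hU
  | insert b B _ ih =>
    intro A
    have hstep : ∀ ρ : Measure PointMeasure, IsFiniteMeasure ρ →
        ρ {μ : PointMeasure | (∀ j ∈ A, μ.toMeasure (I j) = 0) ∧ ∀ j ∈ insert b B, μ.toMeasure (I j) ≠ 0}
        = ρ {μ : PointMeasure | (∀ j ∈ A, μ.toMeasure (I j) = 0) ∧ ∀ j ∈ B, μ.toMeasure (I j) ≠ 0}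
        - ρ {μ | (∀ j ∈ insert b A, μ.toMeasure (I j) = 0) ∧
            ∀ j ∈ B, μ.toMeasure (I j) ≠ 0} := by
      intro ρ _
      have hb := measurableSet_measure_eq_zero (hI b).measurableSet
      rw [← measure_inter_add_sdiff {μ : PointMeasure |
        (∀ j ∈ A, μ.toMeasure (I j) = 0) ∧ ∀ j ∈ B, μ.toMeasure (I j) ≠ 0} hb]
      have e1 : {μ : PointMeasure | (∀ j ∈ A, μ.toMeasure (I j) = 0) ∧
          ∀ j ∈ B, μ.toMeasure (I j) ≠ 0} ∩ {μ | μ.toMeasure (I b) = 0}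
          = {μ | (∀ j ∈ insert b A, μ.toMeasure (I j) = 0) ∧
            ∀ j ∈ B, μ.toMeasure (I j) ≠ 0} := by
        ext μ
        simp only [Set.mem_inter_iff, Set.mem_ofPred_eq, Finset.forall_mem_insert]
        tauto
      have e2 : {μ : PointMeasure | (∀ j ∈ A, μ.toMeasure (I j) = 0) ∧
          ∀ j ∈ B, μ.toMeasure (I j) ≠ 0} \ {μ | μ.toMeasure (I b) = 0}
          = {μ : PointMeasure | (∀ j ∈ A, μ.toMeasure (I j) = 0) ∧
            ∀ j ∈ insert b B, μ.toMeasure (I j) ≠ 0} := by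
        ext μ
        simp only [Set.mem_sdiff, Set.mem_ofPred_eq, Finset.forall_mem_insert]
        tauto
      rw [e1, e2, ENNReal.add_sub_cancel_left (measure_ne_top _ _)]
    simp_rw [fun n => hstep (Qn n) inferInstance]
    rw [hstep Q inferInstance]
    exact ENNReal.Tendsto.sub (ih A) (ih (insert b A)) (Or.inl (measure_ne_top _ _))

open Classical in
/-- The set of cells of the grid of mesh `1 / (m + 1)` in the window `(-K, K]` that are charged
by `μ`. -/
noncomputable def occupied (K m : ℕ) (μ : PointMeasure) : Finset ℤ :=
  (gridIndex K m).filter fun j => μ.toMeasure (gridCell m j) ≠ 0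

/-- The law of the occupied set converges pointwise, hence on every event, as it lives on the
finitely many subsets of `gridIndex K m`. -/
theorem AvoidanceTendsto.tendsto_occupied [∀ n, IsFiniteMeasure (Qn n)] [IsFiniteMeasure Q]
    (h : AvoidanceTendsto Qn Q) (K m : ℕ) (S : Set (Finset ℤ)) :
    Tendsto (fun n => Qn n {μ | occupied K m μ ∈ S}) atTop
      (𝓝 (Q {μ | occupied K m μ ∈ S})) := by
  classical
  have hfib : ∀ s ⊆ gridIndex K m, {μ : PointMeasure | occupied K m μ = s}
      = {μ | (∀ j ∈ gridIndex K m \ s, μ.toMeasure (gridCell m j) = 0) ∧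
        ∀ j ∈ s, μ.toMeasure (gridCell m j) ≠ 0} := by
    intro s hs
    ext μ
    simp only [occupied, Set.mem_ofPred_eq, Finset.ext_iff, Finset.mem_filter, Finset.mem_sdiff]
    constructor
    · intro hμ
      refine ⟨fun j hj => ?_, fun j hj => ((hμ j).mpr hj).2⟩
      by_contra hne
      exact hj.2 ((hμ j).mp ⟨hj.1, hne⟩)
    · rintro ⟨h1, h2⟩ j
      refine ⟨fun hj => ?_, fun hj => ⟨hs hj, h2 j hj⟩⟩
      by_contra hne
      exact hj.2 (h1 j ⟨hj.1, hne⟩)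
  have hmeas : ∀ s ⊆ gridIndex K m, MeasurableSet {μ : PointMeasure | occupied K m μ = s} := by
    intro s hs
    have hj := fun j => measurableSet_measure_eq_zero (measurableSet_gridCell m j)
    rw [hfib s hs, Set.ofPred_and]
    refine MeasurableSet.inter ?_ ?_
    · simp_rw [Set.ofPred_forall]
      exact Finset.measurableSet_biInter _ fun j _ => hj j
    · simp_rw [Set.ofPred_forall]
      exact Finset.measurableSet_biInter _ fun j _ => (hj j).compl
  have hsum : ∀ ρ : Measure PointMeasure, ρ {μ | occupied K m μ ∈ S}
      = ∑ s ∈ (gridIndex K m).powerset with s ∈ S, ρ {μ | occupied K m μ = s} := by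
    intro ρ
    rw [← measure_biUnion_finset]
    · congr 1
      ext μ
      simp only [Set.mem_ofPred_eq, Set.mem_iUnion, Finset.mem_filter, Finset.mem_powerset,
        exists_prop, exists_eq_right']
      exact ⟨fun h => ⟨Finset.filter_subset _ _, h⟩, fun h => h.2⟩
    · intro s _ t _ hst
      exact Set.disjoint_left.mpr fun μ hs ht => hst (Eq.trans (Eq.symm hs) ht)
    · exact fun s hs => hmeas s (Finset.mem_powerset.mp (Finset.mem_filter.mp hs).1)
  simp_rw [hsum]
  refine tendsto_finsetSum _ fun s hs => ?_
  rw [hfib s (Finset.mem_powerset.mp (Finset.mem_filter.mp hs).1)]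
  exact h.tendsto_avoid_hit (ordConnected_gridCell m) s _

/-! ### Cells with several points and cells hitting an exceptional set -/

/-- Some cell of the window has at least two points, or some cell with index in `H` has at least
one. Off this event the occupied set determines the counts of all cells. -/
def badEvent (K m : ℕ) (H : Set ℤ) : Set PointMeasure :=
  {μ | ∃ j ∈ gridIndex K m, 1 < μ.toMeasure (gridCell m j) ∨
    (j ∈ H ∧ μ.toMeasure (gridCell m j) ≠ 0)}

open Classical in
/-- The number of points of the window in excess of one per cell, plus the number of points in the
cells with index in `H`. It is at least one on `badEvent K m H`, and its mean under the limit law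
bounds the probability of that event. -/
noncomputable def excess (K m : ℕ) (H : Set ℤ) (μ : PointMeasure) : ℝ≥0∞ :=
  ∑ j ∈ gridIndex K m, (μ.toMeasure (gridCell m j) - 1) +
    ∑ j ∈ gridIndex K m with j ∈ H, μ.toMeasure (gridCell m j)

theorem measurable_excess (K m : ℕ) (H : Set ℤ) : Measurable (excess K m H) := by
  have h := fun j => measurable_apply (measurableSet_gridCell m j)
  unfold excess
  refine Measurable.add ?_ ?_
  · exact Finset.measurable_fun_sum _ fun j _ => (h j).sub_const 1
  · exact Finset.measurable_fun_sum _ fun j _ => h j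

theorem one_le_excess {K m : ℕ} {H : Set ℤ} {μ : PointMeasure} (hμ : μ ∈ badEvent K m H) :
    1 ≤ excess K m H μ := by
  classical
  obtain ⟨j, hj, h | ⟨hjH, h⟩⟩ := hμ
  · have h2 := μ.two_le_measure (measurableSet_gridCell m j) (isBounded_gridCell m j) h
    calc (1 : ℝ≥0∞) ≤ μ.toMeasure (gridCell m j) - 1 := by
          refine ENNReal.le_sub_of_add_le_left ENNReal.one_ne_top ?_
          rwa [one_add_one_eq_two]
      _ ≤ ∑ j ∈ gridIndex K m, (μ.toMeasure (gridCell m j) - 1) :=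
          Finset.single_le_sum (f := fun j => μ.toMeasure (gridCell m j) - 1)
            (fun _ _ => zero_le) hj
      _ ≤ _ := le_self_add
  · calc (1 : ℝ≥0∞) ≤ μ.toMeasure (gridCell m j) :=
          μ.one_le_measure (measurableSet_gridCell m j) (isBounded_gridCell m j) h
      _ ≤ ∑ j ∈ gridIndex K m with j ∈ H, μ.toMeasure (gridCell m j) :=
          Finset.single_le_sum (f := fun j => μ.toMeasure (gridCell m j))
            (fun _ _ => zero_le) (Finset.mem_filter.mpr ⟨hj, hjH⟩)
      _ ≤ _ := le_add_self

theorem measure_badEvent_le (ρ : Measure PointMeasure) (K m : ℕ) (H : Set ℤ) :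
    ρ (badEvent K m H) ≤ ∫⁻ μ, excess K m H μ ∂ρ := by
  have h := mul_meas_ge_le_lintegral (μ := ρ) (measurable_excess K m H) 1
  rw [one_mul] at h
  exact (measure_mono fun μ hμ => one_le_excess hμ).trans h

theorem _root_.ENNReal.eventually_finsetSum_le {ι : Type*} (s : Finset ι) {f : ι → ℕ → ℝ≥0∞}
    {a : ι → ℝ≥0∞} (h : ∀ i ∈ s, ∀ ε > 0, ∀ᶠ n in atTop, f i n ≤ a i + ε) :
    ∀ ε > 0, ∀ᶠ n in atTop, ∑ i ∈ s, f i n ≤ ∑ i ∈ s, a i + ε := by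
  classical
  induction s using Finset.induction_on with
  | empty => simp
  | insert i s hi ih =>
    intro ε hε
    have hε2 : ε / 2 > 0 := ENNReal.half_pos hε.ne'
    filter_upwards [h i (Finset.mem_insert_self i s) _ hε2,
      ih (fun j hj => h j (Finset.mem_insert_of_mem hj)) _ hε2] with n h1 h2
    rw [Finset.sum_insert hi, Finset.sum_insert hi]
    calc f i n + ∑ i ∈ s, f i n ≤ (a i + ε / 2) + (∑ i ∈ s, a i + ε / 2) := add_le_add h1 h2
      _ = a i + ∑ i ∈ s, a i + (ε / 2 + ε / 2) := by ring
      _ = _ := by rw [ENNReal.add_halves]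

/-- `E[N(I)] = E[(N(I) - 1)⁺] + P(N(I) ≠ 0)`, where subtraction truncates in `ℝ≥0∞`. -/
theorem lintegral_measure_eq (ρ : Measure PointMeasure) (m : ℕ) (j : ℤ) :
    ∫⁻ μ, μ.toMeasure (gridCell m j) ∂ρ = ∫⁻ μ, (μ.toMeasure (gridCell m j) - 1) ∂ρ +
      ρ {μ | μ.toMeasure (gridCell m j) ≠ 0} := by
  have hm := measurable_apply (measurableSet_gridCell m j)
  have hs : MeasurableSet {μ : PointMeasure | μ.toMeasure (gridCell m j) ≠ 0} :=
    (measurableSet_measure_eq_zero (measurableSet_gridCell m j)).compl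
  rw [← lintegral_indicator_one hs, ← lintegral_add_left (hm.sub_const 1)]
  refine lintegral_congr fun μ => ?_
  by_cases h : μ.toMeasure (gridCell m j) = 0
  · simp [h]
  · rw [Set.indicator_of_mem h, Pi.one_apply, tsub_add_cancel_of_le
      (μ.one_le_measure (measurableSet_gridCell m j) (isBounded_gridCell m j) h)]

theorem measure_one_lt_add_le (ρ : Measure PointMeasure) (m : ℕ) (j : ℤ) :
    ρ {μ | 1 < μ.toMeasure (gridCell m j)} + ρ {μ | μ.toMeasure (gridCell m j) ≠ 0} ≤
      ∫⁻ μ, μ.toMeasure (gridCell m j) ∂ρ := by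
  rw [lintegral_measure_eq]
  gcongr
  have h := mul_meas_ge_le_lintegral (μ := ρ)
    ((measurable_apply (measurableSet_gridCell m j)).sub_const 1) 1
  rw [one_mul] at h
  refine (measure_mono fun μ hμ => ?_).trans h
  refine ENNReal.le_sub_of_add_le_left ENNReal.one_ne_top ?_
  rw [one_add_one_eq_two]
  exact μ.two_le_measure (measurableSet_gridCell m j) (isBounded_gridCell m j) hμ

/-- The mean bound and the avoidance functions together control multiple points: a cell contains
at least two points with probability at most `E[Nₙ(I)] - P(Nₙ(I) ≠ 0)`. -/
theorem eventually_measure_badEvent_le [∀ n, IsFiniteMeasure (Pn n)] [IsFiniteMeasure P]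
    (hfin : ∀ I : Set ℝ, I.OrdConnected → Bornology.IsBounded I →
      ∫⁻ μ, μ.toMeasure I ∂P < ∞)
    (hmean : ∀ I : Set ℝ, I.OrdConnected →
      limsup (fun n => ∫⁻ μ, μ.toMeasure I ∂(Pn n)) atTop ≤ ∫⁻ μ, μ.toMeasure I ∂P)
    (h : AvoidanceTendsto Pn P) (K m : ℕ) (H : Set ℤ) :
    ∀ ε > 0, ∀ᶠ n in atTop, Pn n (badEvent K m H) ≤ ∫⁻ μ, excess K m H μ ∂P + ε := by
  classical
  have hhit : ∀ j, ∀ ε > 0, ∀ᶠ n in atTop,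
      P {μ | μ.toMeasure (gridCell m j) ≠ 0} ≤ Pn n {μ | μ.toMeasure (gridCell m j) ≠ 0} + ε ∧
      Pn n {μ | μ.toMeasure (gridCell m j) ≠ 0} ≤ P {μ | μ.toMeasure (gridCell m j) ≠ 0} + ε := by
    intro j ε hε
    have h1 := h.tendsto_avoid_hit (ordConnected_gridCell m) {j} ∅
    simp only [Finset.notMem_empty, false_imp_iff, implies_true, true_and,
      Finset.mem_singleton, forall_eq] at h1
    filter_upwards [(ENNReal.tendsto_nhds (measure_ne_top _ _)).mp h1 ε hε] with n hn
    exact ⟨tsub_le_iff_right.mp hn.1, hn.2⟩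
  have hone : ∀ j ∈ gridIndex K m, ∀ ε > 0, ∀ᶠ n in atTop,
      Pn n {μ | 1 < μ.toMeasure (gridCell m j)}
        ≤ ∫⁻ μ, (μ.toMeasure (gridCell m j) - 1) ∂P + ε := by
    intro j _ ε hε
    have hε2 : ε / 2 > 0 := ENNReal.half_pos hε.ne'
    have hfj := hfin _ (ordConnected_gridCell m j) (isBounded_gridCell m j)
    have h1 : ∀ᶠ n in atTop, ∫⁻ μ, μ.toMeasure (gridCell m j) ∂(Pn n)
        < ∫⁻ μ, μ.toMeasure (gridCell m j) ∂P + ε / 2 :=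
      eventually_lt_of_limsup_lt ((hmean _ (ordConnected_gridCell m j)).trans_lt
        (ENNReal.lt_add_right hfj.ne hε2.ne'))
    filter_upwards [h1, hhit j _ hε2] with n hn hn'
    refine (ENNReal.add_le_add_iff_right
      (measure_ne_top P {μ | μ.toMeasure (gridCell m j) ≠ 0})).mp ?_
    calc Pn n {μ | 1 < μ.toMeasure (gridCell m j)} + P {μ | μ.toMeasure (gridCell m j) ≠ 0}
        ≤ Pn n {μ | 1 < μ.toMeasure (gridCell m j)} +
          (Pn n {μ | μ.toMeasure (gridCell m j) ≠ 0} + ε / 2) := by gcongr; exact hn'.1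
      _ = Pn n {μ | 1 < μ.toMeasure (gridCell m j)} +
          Pn n {μ | μ.toMeasure (gridCell m j) ≠ 0} + ε / 2 := by ring
      _ ≤ ∫⁻ μ, μ.toMeasure (gridCell m j) ∂(Pn n) + ε / 2 := by
          gcongr; exact measure_one_lt_add_le _ m j
      _ ≤ (∫⁻ μ, μ.toMeasure (gridCell m j) ∂P + ε / 2) + ε / 2 := by gcongr
      _ = ∫⁻ μ, (μ.toMeasure (gridCell m j) - 1) ∂P +
          P {μ | μ.toMeasure (gridCell m j) ≠ 0} + (ε / 2 + ε / 2) := by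
          rw [lintegral_measure_eq]; ring
      _ = _ := by rw [ENNReal.add_halves]; ring
  have htwo : ∀ j ∈ (gridIndex K m).filter (· ∈ H), ∀ ε > 0, ∀ᶠ n in atTop,
      Pn n {μ | μ.toMeasure (gridCell m j) ≠ 0} ≤ ∫⁻ μ, μ.toMeasure (gridCell m j) ∂P + ε := by
    intro j _ ε hε
    filter_upwards [hhit j ε hε] with n hn
    refine hn.2.trans ?_
    gcongr
    rw [lintegral_measure_eq]
    exact le_add_self
  intro ε hε
  have hε2 : ε / 2 > 0 := ENNReal.half_pos hε.ne'
  filter_upwards [ENNReal.eventually_finsetSum_le _ hone _ hε2,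
    ENNReal.eventually_finsetSum_le _ htwo _ hε2] with n h1 h2
  have hcell := fun j => measurable_apply (measurableSet_gridCell m j)
  have hexc : ∫⁻ μ, excess K m H μ ∂P
      = ∑ j ∈ gridIndex K m, ∫⁻ μ, (μ.toMeasure (gridCell m j) - 1) ∂P +
        ∑ j ∈ gridIndex K m with j ∈ H, ∫⁻ μ, μ.toMeasure (gridCell m j) ∂P := by
    unfold excess
    rw [lintegral_add_left (Finset.measurable_fun_sum _ fun j _ => (hcell j).sub_const 1),
      lintegral_finsetSum _ fun j _ => (hcell j).sub_const 1,
      lintegral_finsetSum _ fun j _ => hcell j]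
  have hsub : badEvent K m H ⊆
      (⋃ j ∈ gridIndex K m, {μ | 1 < μ.toMeasure (gridCell m j)}) ∪
        ⋃ j ∈ (gridIndex K m).filter (· ∈ H), {μ | μ.toMeasure (gridCell m j) ≠ 0} := by
    rintro μ ⟨j, hj, hμ | ⟨hjH, hμ⟩⟩
    · exact Or.inl (Set.mem_iUnion₂.mpr ⟨j, hj, hμ⟩)
    · exact Or.inr (Set.mem_iUnion₂.mpr ⟨j, Finset.mem_filter.mpr ⟨hj, hjH⟩, hμ⟩)
  calc Pn n (badEvent K m H) ≤ _ := (measure_mono hsub).trans (measure_union_le _ _)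
    _ ≤ _ := add_le_add ((measure_biUnion_finset_le _ _).trans h1)
        ((measure_biUnion_finset_le _ _).trans h2)
    _ = ∫⁻ μ, excess K m H μ ∂P + (ε / 2 + ε / 2) := by rw [hexc]; ring
    _ = _ := by rw [ENNReal.add_halves]

/-- An event that, off `badEvent K m H`, depends only on the occupied cells has almost the same
probability under `Qₙ` as under `Q`. -/
theorem eventually_measure_le_of_occupied [∀ n, IsFiniteMeasure (Pn n)] [IsFiniteMeasure P]
    (hQPn : ∀ n, Qn n ≤ Pn n) (hQP : Q ≤ P)
    (hfin : ∀ I : Set ℝ, I.OrdConnected → Bornology.IsBounded I →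
      ∫⁻ μ, μ.toMeasure I ∂P < ∞)
    (hmean : ∀ I : Set ℝ, I.OrdConnected →
      limsup (fun n => ∫⁻ μ, μ.toMeasure I ∂(Pn n)) atTop ≤ ∫⁻ μ, μ.toMeasure I ∂P)
    (hP : AvoidanceTendsto Pn P) (hQ : AvoidanceTendsto Qn Q) (K m : ℕ) (H : Set ℤ)
    {A : Set PointMeasure} (hA : ∀ μ ∈ A, ∀ ν, μ ∉ badEvent K m H → ν ∉ badEvent K m H →
      occupied K m μ = occupied K m ν → ν ∈ A) {ε : ℝ≥0∞} (hε : 0 < ε) :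
    ∀ᶠ n in atTop, Qn n A ≤ Q A + (2 * ∫⁻ μ, excess K m H μ ∂P + ε) ∧
      Q A ≤ Qn n A + (2 * ∫⁻ μ, excess K m H μ ∂P + ε) := by
  have : ∀ n, IsFiniteMeasure (Qn n) := fun n => isFiniteMeasure_of_le _ (hQPn n)
  have : IsFiniteMeasure Q := isFiniteMeasure_of_le _ hQP
  have hε2 : ε / 2 > 0 := ENNReal.half_pos hε.ne'
  -- `A` and the event `occupied K m μ ∈ S` agree off the bad event.
  set S : Set (Finset ℤ) := occupied K m '' (A \ badEvent K m H) with hS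
  have h1 : A ⊆ {μ | occupied K m μ ∈ S} ∪ badEvent K m H := by
    intro μ hμ
    by_cases hb : μ ∈ badEvent K m H
    · exact Or.inr hb
    · exact Or.inl ⟨μ, ⟨hμ, hb⟩, rfl⟩
  have h2 : {μ | occupied K m μ ∈ S} ⊆ A ∪ badEvent K m H := by
    rintro ν ⟨μ, ⟨hμ, hb⟩, hμν⟩
    by_cases hb' : ν ∈ badEvent K m H
    · exact Or.inr hb'
    · exact Or.inl (hA μ hμ ν hb hb' hμν)
  have hQbad : Q (badEvent K m H) ≤ ∫⁻ μ, excess K m H μ ∂P :=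
    (hQP _).trans (measure_badEvent_le P K m H)
  filter_upwards [(ENNReal.tendsto_nhds (measure_ne_top _ _)).mp (hQ.tendsto_occupied K m S)
      _ hε2, eventually_measure_badEvent_le hfin hmean hP K m H _ hε2] with n hn hb
  have hQnbad := (hQPn n _).trans hb
  have hn1 := tsub_le_iff_right.mp hn.1
  constructor
  · calc Qn n A ≤ Qn n {μ | occupied K m μ ∈ S} + Qn n (badEvent K m H) :=
          (measure_mono h1).trans (measure_union_le _ _)
      _ ≤ (Q A + ∫⁻ μ, excess K m H μ ∂P + ε / 2) + (∫⁻ μ, excess K m H μ ∂P + ε / 2) := by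
          refine add_le_add (hn.2.trans ?_) hQnbad
          gcongr
          exact (measure_mono h2).trans ((measure_union_le _ _).trans (by gcongr))
      _ = Q A + (2 * ∫⁻ μ, excess K m H μ ∂P + (ε / 2 + ε / 2)) := by ring
      _ = _ := by rw [ENNReal.add_halves]
  · calc Q A ≤ Q {μ | occupied K m μ ∈ S} + Q (badEvent K m H) :=
          (measure_mono h1).trans (measure_union_le _ _)
      _ ≤ (Qn n A + (∫⁻ μ, excess K m H μ ∂P + ε / 2) + ε / 2) +
          ∫⁻ μ, excess K m H μ ∂P := by
          refine add_le_add (hn1.trans ?_) hQbad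
          gcongr
          exact (measure_mono h2).trans ((measure_union_le _ _).trans (by gcongr))
      _ = Qn n A + (2 * ∫⁻ μ, excess K m H μ ∂P + (ε / 2 + ε / 2)) := by ring
      _ = _ := by rw [ENNReal.add_halves]

end PointMeasure

/-! ### The excess vanishes as the mesh tends to zero -/

namespace PointMeasure

theorem exists_ball_measure_le_one {μ : PointMeasure} (hμ : μ.IsSimple) (x : ℝ) :
    ∃ r > 0, μ.toMeasure (Metric.ball x r) ≤ 1 := by
  have h := tendsto_measure_cthickening_of_isCompact (μ := μ.toMeasure)
    (isCompact_singleton (x := x))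
  have h2 : ∀ᶠ r in 𝓝[>] (0 : ℝ), μ.toMeasure (Metric.cthickening r {x}) < 2 :=
    (h.mono_left nhdsWithin_le_nhds).eventually_lt_const
      ((hμ x).trans_lt ENNReal.one_lt_two)
  obtain ⟨r, hr, hr0⟩ := (h2.and self_mem_nhdsWithin).exists
  refine ⟨r, hr0, ?_⟩
  by_contra! hc
  refine absurd (μ.two_le_measure measurableSet_ball Metric.isBounded_ball hc) (not_le.mpr ?_)
  refine (measure_mono ?_).trans_lt hr
  rw [← Metric.thickening_singleton]
  exact Metric.thickening_subset_cthickening r {x}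

/-- A simple point measure has at most one point in each cell of a fine grid: a Lebesgue number
argument on the compact window. -/
theorem IsSimple.eventually_gridCell_le_one {μ : PointMeasure} (hμ : μ.IsSimple) (K : ℕ) :
    ∀ᶠ m : ℕ in atTop, ∀ j ∈ gridIndex K m, μ.toMeasure (gridCell m j) ≤ 1 := by
  choose r hr0 hr using exists_ball_measure_le_one hμ
  obtain ⟨δ, hδ, hδs⟩ := lebesgue_number_lemma_of_metric (isCompact_Icc (a := -(K : ℝ)) (b := K))
    (c := fun x => Metric.ball x (r x)) (fun x => Metric.isOpen_ball)
    fun x _ => Set.mem_iUnion.mpr ⟨x, Metric.mem_ball_self (hr0 x)⟩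
  filter_upwards [tendsto_one_div_add_atTop_nhds_zero_nat.eventually_lt_const hδ] with m hm j hj
  obtain ⟨x, hx⟩ := nonempty_gridCell m j
  obtain ⟨i, hi⟩ := hδs x (Set.Ioc_subset_Icc_self (gridCell_subset_window hj hx))
  refine (measure_mono fun y hy => hi ?_).trans (hr i)
  rw [Metric.mem_ball, Real.dist_eq]
  exact (abs_sub_le_of_mem_gridCell hy hx).trans_lt hm

theorem eventually_gridCell_eq_zero (μ : PointMeasure) {F : Set ℝ} (hF : IsCompact F)
    (hμ : μ.toMeasure F = 0) :
    ∀ᶠ m : ℕ in atTop, ∀ j, (gridCell m j ∩ F).Nonempty → μ.toMeasure (gridCell m j) = 0 := by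
  have h := tendsto_measure_cthickening_of_isCompact (μ := μ.toMeasure) hF
  rw [hμ] at h
  filter_upwards [(h.comp tendsto_one_div_add_atTop_nhds_zero_nat).eventually_lt_const
    one_pos] with m hm j hj
  obtain ⟨x, hx, hxF⟩ := hj
  by_contra hne
  refine absurd (μ.one_le_measure (measurableSet_gridCell m j) (isBounded_gridCell m j) hne)
    (not_le.mpr (lt_of_le_of_lt (measure_mono fun y hy => ?_) hm))
  refine Metric.mem_cthickening_of_dist_le y x _ F hxF ?_
  rw [Real.dist_eq]
  exact abs_sub_le_of_mem_gridCell hy hx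

theorem excess_le (K m : ℕ) (H : Set ℤ) (μ : PointMeasure) :
    excess K m H μ ≤ 2 * μ.toMeasure (Set.Ioc (-(K : ℝ)) K) := by
  classical
  have hw : μ.toMeasure (Set.Ioc (-(K : ℝ)) K)
      = ∑ j ∈ gridIndex K m, μ.toMeasure (gridCell m j) := by
    rw [measure_eq_sum_inter_gridCell _ m measurableSet_Ioc subset_rfl]
    exact Finset.sum_congr rfl fun j hj =>
      by rw [Set.inter_eq_right.mpr (gridCell_subset_window hj)]
  rw [two_mul, hw, excess]
  exact add_le_add (Finset.sum_le_sum fun j _ => tsub_le_self)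
    (Finset.sum_le_sum_of_subset (Finset.filter_subset _ _))

/-- Dominated convergence: the excess is at most twice the number of points of the window, and it
vanishes eventually if the point measure is simple and does not charge `F`. -/
theorem tendsto_lintegral_excess {Ω : Type*} [MeasurableSpace Ω] {P : Measure Ω}
    {N : Ω → PointMeasure} (hN : Measurable N) (hsimple : ∀ᵐ ω ∂P, (N ω).IsSimple)
    (hfin : ∀ I : Set ℝ, I.OrdConnected → Bornology.IsBounded I →
      ∫⁻ ω, (N ω).toMeasure I ∂P < ∞) (K : ℕ) {F : Set ℝ} (hF : IsCompact F)
    (hNF : ∀ᵐ ω ∂P, (N ω).toMeasure F = 0) :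
    Tendsto (fun m => ∫⁻ μ, excess K m {j | (gridCell m j ∩ F).Nonempty} μ ∂(P.map N)) atTop
      (𝓝 0) := by
  classical
  have hmap := fun m => lintegral_map (μ := P)
    (measurable_excess K m {j | (gridCell m j ∩ F).Nonempty}) hN
  rw [funext hmap]
  rw [← lintegral_zero (μ := P)]
  refine tendsto_lintegral_of_dominated_convergence
    (fun ω => 2 * (N ω).toMeasure (Set.Ioc (-(K : ℝ)) K))
    (fun m => (measurable_excess K m _).comp hN)
    (fun m => Eventually.of_forall fun ω => excess_le K m _ _) ?_ ?_
  · have hmeas : Measurable fun ω => (N ω).toMeasure (Set.Ioc (-(K : ℝ)) K) :=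
      (measurable_apply measurableSet_Ioc).comp hN
    rw [lintegral_const_mul _ hmeas]
    exact ENNReal.mul_ne_top ENNReal.ofNat_ne_top
      (hfin _ Set.ordConnected_Ioc (Metric.isBounded_Ioc _ _)).ne
  · filter_upwards [hsimple, hNF] with ω h1 h2
    refine tendsto_const_nhds.congr' ?_
    filter_upwards [h1.eventually_gridCell_le_one K,
      (N ω).eventually_gridCell_eq_zero hF h2] with m h3 h4
    symm
    unfold excess
    rw [Finset.sum_eq_zero fun j hj => tsub_eq_zero_of_le (h3 j hj), zero_add]
    exact Finset.sum_eq_zero fun j hj => h4 j (Finset.mem_filter.mp hj).2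

/-! ### Counts of continuity sets -/

theorem measure_gridCell_eq_ite {K m : ℕ} {H : Set ℤ} {μ : PointMeasure}
    (hμ : μ ∉ badEvent K m H) {j : ℤ} (hj : j ∈ gridIndex K m) :
    μ.toMeasure (gridCell m j) = if j ∈ occupied K m μ then 1 else 0 := by
  split_ifs with ho
  · refine le_antisymm ?_ (μ.one_le_measure (measurableSet_gridCell m j)
      (isBounded_gridCell m j) (Finset.mem_filter.mp ho).2)
    by_contra! hlt
    exact hμ ⟨j, hj, Or.inl hlt⟩
  · by_contra hne
    exact ho (Finset.mem_filter.mpr ⟨hj, hne⟩)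

/-- Off the bad event for the cells that meet `F`, the count of a set with frontier in `F` is
determined by the occupied cells. -/
theorem measure_eq_of_occupied_eq {K m : ℕ} {F B : Set ℝ} (hB : MeasurableSet B)
    (hBK : B ⊆ Set.Ioc (-(K : ℝ)) K) (hBF : frontier B ⊆ F) {μ ν : PointMeasure}
    (hμ : μ ∉ badEvent K m {j | (gridCell m j ∩ F).Nonempty})
    (hν : ν ∉ badEvent K m {j | (gridCell m j ∩ F).Nonempty})
    (h : occupied K m μ = occupied K m ν) : μ.toMeasure B = ν.toMeasure B := by
  rw [measure_eq_sum_inter_gridCell _ m hB hBK, measure_eq_sum_inter_gridCell _ m hB hBK]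
  refine Finset.sum_congr rfl fun j hj => ?_
  by_cases hjF : (gridCell m j ∩ F).Nonempty
  · have hz : ∀ ρ : PointMeasure, ρ ∉ badEvent K m {j | (gridCell m j ∩ F).Nonempty} →
        ρ.toMeasure (B ∩ gridCell m j) = 0 := by
      intro ρ hρ
      refine measure_mono_null Set.inter_subset_right ?_
      by_contra hne
      exact hρ ⟨j, hj, Or.inr ⟨hjF, hne⟩⟩
    rw [hz μ hμ, hz ν hν]
  · have hdisj : Disjoint (gridCell m j) (frontier B) := by
      rw [Set.disjoint_iff_inter_eq_empty, ← Set.not_nonempty_iff_eq_empty]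
      exact fun hne => hjF (hne.mono (Set.inter_subset_inter_right _ hBF))
    rcases subset_or_disjoint_of_disjoint_frontier hdisj with hsub | hd
    · rw [Set.inter_eq_right.mpr hsub]
      rw [measure_gridCell_eq_ite hμ hj, measure_gridCell_eq_ite hν hj, h]
    · rw [hd.symm.inter_eq, measure_empty, measure_empty]

variable {Ω : Type*} [MeasurableSpace Ω] {P : Measure Ω} [IsProbabilityMeasure P]
  {N : Ω → PointMeasure} {Qn Pn : ℕ → Measure PointMeasure} {Q : Measure PointMeasure}

/-- Convergence of the counts of continuity sets under measures `Qₙ ≤ Pₙ`. The mean bound is needed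
for `Pₙ` only, since it only serves to make bad events rare. -/
theorem tendsto_measure_counts_le [∀ n, IsFiniteMeasure (Pn n)]
    (hN : Measurable N) (hsimple : ∀ᵐ ω ∂P, (N ω).IsSimple)
    (hfin : ∀ I : Set ℝ, I.OrdConnected → Bornology.IsBounded I →
      ∫⁻ ω, (N ω).toMeasure I ∂P < ∞)
    (hmean : ∀ I : Set ℝ, I.OrdConnected →
      limsup (fun n => ∫⁻ μ, μ.toMeasure I ∂(Pn n)) atTop ≤ ∫⁻ μ, μ.toMeasure I ∂(P.map N))
    (hQPn : ∀ n, Qn n ≤ Pn n) (hQP : Q ≤ P.map N)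
    (hP : AvoidanceTendsto Pn (P.map N)) (hQ : AvoidanceTendsto Qn Q)
    {k : ℕ} {B : Fin k → Set ℝ} (hB : ∀ i, IsContinuitySet P N (B i)) (l : Fin k → ℕ) :
    Tendsto (fun n => Qn n {μ | ∀ i, μ.toMeasure (B i) ≤ l i}) atTop
      (𝓝 (Q {μ | ∀ i, μ.toMeasure (B i) ≤ l i})) := by
  have hfin' : ∀ I : Set ℝ, I.OrdConnected → Bornology.IsBounded I →
      ∫⁻ μ, μ.toMeasure I ∂(P.map N) < ∞ := by
    intro I hI hI'
    rw [lintegral_map (measurable_apply hI.measurableSet) hN]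
    exact hfin I hI hI'
  have hpm : IsProbabilityMeasure (P.map N) := Measure.isProbabilityMeasure_map hN.aemeasurable
  obtain ⟨R, hR⟩ := (Bornology.isBounded_iUnion.mpr fun i => (hB i).2.1).subset_closedBall 0
  obtain ⟨K, hK⟩ := exists_nat_gt R
  have hBK : ∀ i, B i ⊆ Set.Ioc (-(K : ℝ)) K := by
    intro i x hx
    have h1 := hR (Set.mem_iUnion.mpr ⟨i, hx⟩)
    rw [Metric.mem_closedBall, dist_zero_right, Real.norm_eq_abs] at h1
    have h2 := abs_lt.mp (h1.trans_lt hK)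
    exact ⟨h2.1, h2.2.le⟩
  have hF : IsCompact (⋃ i, frontier (B i)) := isCompact_iUnion fun i =>
    Metric.isCompact_of_isClosed_isBounded isClosed_frontier
      ((hB i).2.1.closure.subset frontier_subset_closure)
  have hNF : ∀ᵐ ω ∂P, (N ω).toMeasure (⋃ i, frontier (B i)) = 0 := by
    filter_upwards [ae_all_iff.mpr fun i => (hB i).2.2] with ω hω
    exact measure_iUnion_null hω
  refine ENNReal.tendsto_nhds_of_Icc fun ε hε => ?_
  have hε2 : 0 < ε / 2 := ENNReal.half_pos hε.ne'
  have hlim := ENNReal.Tendsto.const_mul (a := 2)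
    (tendsto_lintegral_excess hN hsimple hfin K hF hNF) (Or.inr ENNReal.ofNat_ne_top)
  rw [mul_zero] at hlim
  obtain ⟨m, hm⟩ := (ENNReal.tendsto_nhds_zero.mp hlim (ε / 2) hε2).exists
  have hle := (add_le_add_left hm (ε / 2)).trans_eq (ENNReal.add_halves ε)
  filter_upwards [eventually_measure_le_of_occupied hQPn hQP hfin' hmean hP hQ K m
    {j | (gridCell m j ∩ ⋃ i, frontier (B i)).Nonempty}
    (A := {μ | ∀ i, μ.toMeasure (B i) ≤ l i})
    (fun μ hμ ν hbμ hbν ho i => by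
      rw [← measure_eq_of_occupied_eq (hB i).1 (hBK i) 
        (Set.subset_iUnion (fun i => frontier (B i)) i) hbμ hbν ho]
      exact hμ i) hε2] with n hn
  exact ⟨tsub_le_iff_right.mpr (hn.2.trans (by gcongr)), hn.1.trans (by gcongr)⟩

end PointMeasure

/-! ### The vague topology and the counts of grid cells -/

namespace PointMeasure

/-- `μ` and `ν` have the same counts on all cells of mesh `1 / (m + 1)` in the window `(-K, K]`. -/
def SameCounts (K m : ℕ) (μ ν : PointMeasure) : Prop :=
  ∀ j ∈ gridIndex K m, ν.toMeasure (gridCell m j) = μ.toMeasure (gridCell m j)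

theorem SameCounts.mono {K L m : ℕ} (h : K ≤ L) {μ ν : PointMeasure} (hL : SameCounts L m μ ν) :
    SameCounts K m μ ν :=
  fun j hj => hL j (gridIndex_mono h m hj)

/-- The integral of a test function is close to its Riemann sum over the grid cells. -/
theorem abs_integral_sub_sum_le (μ : PointMeasure) (f : C_c(ℝ, ℝ)) {R m : ℕ} {ε : ℝ}
    (hsupp : ∀ x ∉ Set.Ioc (-(R : ℝ)) R, f x = 0)
    (hε : ∀ x y, |x - y| ≤ 1 / ((m : ℝ) + 1) → |f x - f y| ≤ ε) :
    |∫ x, f x ∂μ.toMeasure -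
        ∑ j ∈ gridIndex R m, μ.toMeasure.real (gridCell m j) * f (((j : ℝ) + 1) / (m + 1))|
      ≤ ε * ∑ j ∈ gridIndex R m, μ.toMeasure.real (gridCell m j) := by
  have hint : ∀ j, IntegrableOn (fun x => f x) (gridCell m j) μ.toMeasure := fun j =>
    (μ.integrable_compactlySupported f).integrableOn
  have hsplit : ∫ x, f x ∂μ.toMeasure
      = ∑ j ∈ gridIndex R m, ∫ x in gridCell m j, f x ∂μ.toMeasure := by
    rw [← integral_biUnion_finset _ (fun j _ => measurableSet_gridCell m j)
      (pairwiseDisjoint_gridCell m _) (fun j _ => hint j), biUnion_gridCell,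
      setIntegral_eq_integral_of_forall_compl_eq_zero hsupp]
  rw [hsplit, ← Finset.sum_sub_distrib, Finset.mul_sum]
  refine (Finset.abs_sum_le_sum_abs _ _).trans (Finset.sum_le_sum fun j _ => ?_)
  have hlt : μ.toMeasure (gridCell m j) < ∞ := μ.measure_lt_top (isBounded_gridCell m j)
  have hconst : ∫ _ in gridCell m j, f (((j : ℝ) + 1) / (m + 1)) ∂μ.toMeasure
      = μ.toMeasure.real (gridCell m j) * f (((j : ℝ) + 1) / (m + 1)) := by
    rw [setIntegral_const, smul_eq_mul]
  rw [← hconst, ← integral_sub (hint j) (integrableOn_const hlt.ne), ← Real.norm_eq_abs]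
  refine norm_setIntegral_le_of_norm_le_const hlt fun x hx => ?_
  rw [Real.norm_eq_abs]
  refine hε _ _ (abs_sub_le_of_mem_gridCell hx ?_)
  have h : (0 : ℝ) < m + 1 := by positivity
  exact ⟨by gcongr; linarith, le_rfl⟩

theorem exists_forall_sameCounts_abs_integral_lt (μ : PointMeasure) (f : C_c(ℝ, ℝ)) {ε : ℝ}
    (hε : 0 < ε) : ∃ K₀ : ℕ, ∀ K ≥ K₀, ∀ m ≥ K, ∀ ν, SameCounts K m μ ν →
      |∫ x, f x ∂ν.toMeasure - ∫ x, f x ∂μ.toMeasure| < ε := by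
  obtain ⟨r, hr⟩ := f.hasCompactSupport.isBounded.subset_closedBall 0
  obtain ⟨R, hR⟩ := exists_nat_gt r
  have hsupp : ∀ x ∉ Set.Ioc (-(R : ℝ)) R, f x = 0 := by
    intro x hx
    by_contra hne
    have h1 : x ∈ Metric.closedBall (0 : ℝ) r := hr (subset_tsupport _ hne)
    rw [Metric.mem_closedBall, dist_zero_right, Real.norm_eq_abs] at h1
    have h2 := abs_lt.mp (h1.trans_lt hR)
    exact hx ⟨h2.1, h2.2.le⟩
  set M : ℝ := μ.toMeasure.real (Set.Ioc (-(R : ℝ)) R) with hM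
  have hM0 : 0 ≤ M := measureReal_nonneg
  have hη : 0 < ε / (2 * (M + 1)) := by positivity
  obtain ⟨δ, hδ, hf⟩ := Metric.uniformContinuous_iff.mp
    (f.hasCompactSupport.uniformContinuous_of_continuous f.continuous) _ hη
  obtain ⟨m₀, hm₀⟩ := eventually_atTop.mp
    (tendsto_one_div_add_atTop_nhds_zero_nat.eventually_lt_const hδ)
  refine ⟨max R m₀, fun K hK m hm ν hν => ?_⟩
  have hosc : ∀ x y, |x - y| ≤ 1 / ((m : ℝ) + 1) → |f x - f y| ≤ ε / (2 * (M + 1)) := by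
    intro x y hxy
    have h1 := hm₀ m (((le_max_right _ _).trans hK).trans hm)
    exact (hf (show dist x y < δ from hxy.trans_lt h1)).le
  have hν' := hν.mono ((le_max_left _ _).trans hK)
  have hsumM : ∑ j ∈ gridIndex R m, μ.toMeasure.real (gridCell m j) = M := by
    rw [hM, measureReal_def, measure_eq_sum_inter_gridCell _ m measurableSet_Ioc subset_rfl,
      ENNReal.toReal_sum fun j _ =>
        (μ.measure_lt_top ((isBounded_gridCell m j).subset Set.inter_subset_right)).ne]
    exact Finset.sum_congr rfl fun j hj => by
      rw [Set.inter_eq_right.mpr (gridCell_subset_window hj), measureReal_def]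
  have hreal : ∀ j ∈ gridIndex R m,
      ν.toMeasure.real (gridCell m j) = μ.toMeasure.real (gridCell m j) := fun j hj => by
    rw [measureReal_def, measureReal_def, hν' j hj]
  have h1 := μ.abs_integral_sub_sum_le f hsupp hosc
  have h2 := ν.abs_integral_sub_sum_le f hsupp hosc
  rw [Finset.sum_congr rfl fun j hj => by rw [hreal j hj], Finset.sum_congr rfl hreal, hsumM] at h2
  rw [hsumM] at h1
  have h3 : ε / (2 * (M + 1)) * M < ε / 2 := by
    rw [div_mul_eq_mul_div, div_lt_div_iff₀ (by positivity) two_pos]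
    nlinarith
  rw [abs_le] at h1 h2
  rw [abs_lt]
  constructor <;> linarith [h1.1, h1.2, h2.1, h2.2]

/-- Point measures that share the counts of `μ` on the cells of a fine grid of a large window lie
in any given vague neighbourhood of `μ`. -/
theorem exists_forall_sameCounts_mem {G : Set PointMeasure} {μ : PointMeasure} (hG : G ∈ 𝓝 μ) :
    ∃ K₀ : ℕ, ∀ K ≥ K₀, ∀ m ≥ K, ∀ ν, SameCounts K m μ ν → ν ∈ G := by
  -- The sets `S K₀` are a basis of a filter along which every test integral converges.
  let S : ℕ → Set PointMeasure := fun K₀ => {ν | ∃ K ≥ K₀, ∃ m ≥ K, SameCounts K m μ ν}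
  have hS : Antitone S := by
    rintro a b hab ν ⟨K, hK, h⟩
    exact ⟨K, hab.trans hK, h⟩
  have hbasis : (⨅ K, 𝓟 (S K)).HasBasis (fun _ => True) S :=
    hasBasis_iInf_principal (directed_of_isDirected_le hS)
  have hle : ⨅ K, 𝓟 (S K) ≤ 𝓝 μ := by
    rw [nhds_induced, ← tendsto_iff_comap, tendsto_pi_nhds]
    intro f
    refine Metric.tendsto_nhds.mpr fun ε hε => ?_
    obtain ⟨K₀, hK₀⟩ := exists_forall_sameCounts_abs_integral_lt μ f hε
    refine hbasis.mem_iff.mpr ⟨K₀, trivial, ?_⟩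
    rintro ν ⟨K, hK, m, hm, hν⟩
    exact hK₀ K hK m hm ν hν
  obtain ⟨K₀, -, hK₀⟩ := hbasis.mem_iff.mp (hle hG)
  exact ⟨K₀, fun K hK m hm ν hν => hK₀ ⟨K, hK, m, hm, hν⟩⟩

/-! ### Weak convergence of the laws -/

/-- The largest subset of `G` that depends only on the counts of the cells of mesh `1 / (m + 1)`
in the window `(-K, K]`. -/
def gridInterior (G : Set PointMeasure) (K m : ℕ) : Set PointMeasure :=
  {μ | ∀ ν, SameCounts K m μ ν → ν ∈ G}

theorem gridInterior_subset (G : Set PointMeasure) (K m : ℕ) : gridInterior G K m ⊆ G :=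
  fun μ hμ => hμ μ fun _ _ => rfl

theorem sameCounts_of_occupied_eq {K m : ℕ} {μ ν : PointMeasure}
    (hμ : μ ∉ badEvent K m ∅) (hν : ν ∉ badEvent K m ∅) (h : occupied K m μ = occupied K m ν) :
    SameCounts K m μ ν := by
  intro j hj
  rw [measure_gridCell_eq_ite hμ hj, measure_gridCell_eq_ite hν hj, h]

variable {Ω : Type*} [MeasurableSpace Ω] {P : Measure Ω} [IsProbabilityMeasure P]
  {N : Ω → PointMeasure} {Pn : ℕ → Measure PointMeasure}

/-- The portmanteau condition on vaguely open sets for the laws of the point processes. -/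
theorem measure_le_liminf_of_isOpen [∀ n, IsFiniteMeasure (Pn n)]
    (hN : Measurable N) (hsimple : ∀ᵐ ω ∂P, (N ω).IsSimple)
    (hfin : ∀ I : Set ℝ, I.OrdConnected → Bornology.IsBounded I →
      ∫⁻ ω, (N ω).toMeasure I ∂P < ∞)
    (hmean : ∀ I : Set ℝ, I.OrdConnected →
      limsup (fun n => ∫⁻ μ, μ.toMeasure I ∂(Pn n)) atTop ≤ ∫⁻ μ, μ.toMeasure I ∂(P.map N))
    (hP : AvoidanceTendsto Pn (P.map N)) {G : Set PointMeasure} (hG : IsOpen G) :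
    P.map N G ≤ liminf (fun n => Pn n G) atTop := by
  have hfin' : ∀ I : Set ℝ, I.OrdConnected → Bornology.IsBounded I →
      ∫⁻ μ, μ.toMeasure I ∂(P.map N) < ∞ := by
    intro I hI hI'
    rw [lintegral_map (measurable_apply hI.measurableSet) hN]
    exact hfin I hI hI'
  have hpm : IsProbabilityMeasure (P.map N) := Measure.isProbabilityMeasure_map hN.aemeasurable
  -- `L K` increases to `G`; the mesh is left free so that it can be chosen after the window.
  let L : ℕ → Set PointMeasure := fun K => ⋂ m ≥ K, gridInterior G K m
  have hLmono : Monotone L := by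
    intro a b hab μ hμ
    refine Set.mem_iInter₂.mpr fun m hm ν hν => ?_
    exact Set.mem_iInter₂.mp hμ m (hab.trans hm) ν (hν.mono hab)
  have hLG : ⋃ K, L K = G := by
    refine Set.Subset.antisymm (Set.iUnion_subset fun K μ hμ =>
      gridInterior_subset G K K (Set.mem_iInter₂.mp hμ K le_rfl)) fun μ hμ => ?_
    obtain ⟨K₀, hK₀⟩ := exists_forall_sameCounts_mem (hG.mem_nhds hμ)
    exact Set.mem_iUnion.mpr ⟨K₀, Set.mem_iInter₂.mpr fun m hm => hK₀ K₀ le_rfl m hm⟩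
  have hlim := tendsto_measure_iUnion_atTop (μ := P.map N) hLmono
  rw [hLG] at hlim
  refine le_of_tendsto' hlim fun K => ENNReal.le_of_forall_pos_le_add fun ε hε _ => ?_
  have hε0 : (0 : ℝ≥0∞) < ε := by exact_mod_cast hε
  have hε2 : 0 < (ε : ℝ≥0∞) / 2 := ENNReal.half_pos hε0.ne'
  have hexc := ENNReal.Tendsto.const_mul (a := 2)
    (tendsto_lintegral_excess hN hsimple hfin K isCompact_empty
      (Eventually.of_forall fun ω => measure_empty)) (Or.inr ENNReal.ofNat_ne_top)
  simp only [Set.inter_empty, Set.not_nonempty_empty, Set.ofPred_false, mul_zero] at hexc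
  obtain ⟨m, hm, hmK⟩ := ((ENNReal.tendsto_nhds_zero.mp hexc (ε / 2) hε2).and
    (eventually_ge_atTop K)).exists
  have hle := (add_le_add_left hm ((ε : ℝ≥0∞) / 2)).trans_eq (ENNReal.add_halves _)
  have hev := eventually_measure_le_of_occupied (fun n => le_rfl) le_rfl hfin' hmean hP hP K m ∅
    (A := gridInterior G K m)
    (fun μ hμ ν hbμ hbν ho ρ hρ => hμ ρ fun j hj =>
      (hρ j hj).trans (sameCounts_of_occupied_eq hbμ hbν ho j hj)) hε2
  have hLK : L K ⊆ gridInterior G K m := Set.iInter₂_subset m hmK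
  rw [Function.comp_apply, ← tsub_le_iff_right]
  refine le_liminf_of_le (by isBoundedDefault) ?_
  filter_upwards [hev] with n hn
  rw [tsub_le_iff_right]
  calc P.map N (L K) ≤ P.map N (gridInterior G K m) := measure_mono hLK
    _ ≤ _ := hn.2
    _ ≤ Pn n G + ε := add_le_add (measure_mono (gridInterior_subset G K m)) hle

end PointMeasure

/-! ### Removing the constraint on the real variable -/

/-- Joint convergence to a product, on the half-lines `Yₙ ≤ y`, gives convergence of the second
marginal: `P(Y ≤ y)` tends to one as `y → ∞`. -/
theorem tendsto_measure_of_forall_tendsto_le {Ωn : ℕ → Type*} [∀ n, MeasurableSpace (Ωn n)]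
    {Pn : ∀ n, Measure (Ωn n)} [∀ n, IsProbabilityMeasure (Pn n)]
    {Ω : Type*} [MeasurableSpace Ω] {P : Measure Ω} [IsProbabilityMeasure P]
    {Yn : ∀ n, Ωn n → ℝ} {Y : Ω → ℝ} (hYn : ∀ n, Measurable (Yn n)) (hY : Measurable Y)
    {A : ∀ n, Set (Ωn n)} {a : ℝ≥0∞} (ha : a ≠ ∞)
    (hYlim : ∀ y, Tendsto (fun n => Pn n {ω | Yn n ω ≤ y}) atTop (𝓝 (P {ω | Y ω ≤ y})))
    (h : ∀ y, Tendsto (fun n => Pn n {ω | Yn n ω ≤ y ∧ ω ∈ A n}) atTop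
      (𝓝 (P {ω | Y ω ≤ y} * a))) :
    Tendsto (fun n => Pn n (A n)) atTop (𝓝 a) := by
  have htop : Tendsto (fun y => P {ω | Y ω ≤ y}) atTop (𝓝 1) := by
    have hpm : IsProbabilityMeasure (P.map Y) := Measure.isProbabilityMeasure_map hY.aemeasurable
    have h1 := tendsto_measure_Iic_atTop (P.map Y)
    rw [measure_univ] at h1
    exact h1.congr fun y => Measure.map_apply hY measurableSet_Iic
  have hinf : a ≤ liminf (fun n => Pn n (A n)) atTop := by
    have h1 := ENNReal.Tendsto.mul_const htop (Or.inr ha)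
    rw [one_mul] at h1
    refine le_of_tendsto' h1 fun y => ?_
    rw [← (h y).liminf_eq]
    exact liminf_le_liminf (Eventually.of_forall fun n => measure_mono fun ω hω => hω.2)
  have hsup : limsup (fun n => Pn n (A n)) atTop ≤ a := by
    have h1 : Tendsto (fun y => P {ω | Y ω ≤ y} * a + (1 - P {ω | Y ω ≤ y})) atTop
        (𝓝 (1 * a + (1 - 1))) :=
      (ENNReal.Tendsto.mul_const htop (Or.inr ha)).add
        (ENNReal.Tendsto.sub tendsto_const_nhds htop (Or.inl ENNReal.one_ne_top))
    rw [one_mul, tsub_self, add_zero] at h1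
    refine ge_of_tendsto' h1 fun y => ?_
    have h2 := (h y).add (ENNReal.Tendsto.sub (tendsto_const_nhds (x := (1 : ℝ≥0∞))) (hYlim y)
      (Or.inl ENNReal.one_ne_top))
    rw [← h2.limsup_eq]
    refine limsup_le_limsup (Eventually.of_forall fun n => ?_)
    have h3 : Pn n {ω | Yn n ω ≤ y}ᶜ = 1 - Pn n {ω | Yn n ω ≤ y} :=
      prob_compl_eq_one_sub (hYn n measurableSet_Iic)
    simp only [← h3]
    refine (measure_mono fun ω hω => ?_).trans (measure_union_le _ _)
    by_cases hy : Yn n ω ≤ y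
    · exact Or.inl ⟨hy, hω⟩
    · exact Or.inr hy
  exact tendsto_of_le_liminf_of_limsup_le hinf hsup

/-! ### Kallenberg's theorem with an asymptotically independent variable -/

/-- **Extension of Kallenberg's theorem.** -/
theorem theorem2p7
    {Ωn : ℕ → Type*} [∀ n, MeasurableSpace (Ωn n)]
    (Pn : ∀ n, Measure (Ωn n)) [∀ n, IsProbabilityMeasure (Pn n)]
    {Ω : Type*} [MeasurableSpace Ω] (P : Measure Ω) [IsProbabilityMeasure P]
    (Yn : ∀ n, Ωn n → ℝ) (Y : Ω → ℝ)
    (Nn : ∀ n, Ωn n → PointMeasure) (N : Ω → PointMeasure)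
    (hYn_meas : ∀ n, Measurable (Yn n)) (hY_meas : Measurable Y)
    (hNn_meas : ∀ n, Measurable (Nn n)) (hN_meas : Measurable N)
    (hY : TendstoInDistribution Yn atTop Y Pn P)
    (hN_simple : ∀ᵐ ω ∂P, (N ω).IsSimple)
    (hN_indep : IndepFun Y N P)
    (hN_finite : ∀ I : Set ℝ, I.OrdConnected → Bornology.IsBounded I →
      ∫⁻ ω, (N ω).toMeasure I ∂P < ∞)
    (K1 : ∀ I : Set ℝ, I.OrdConnected →
      limsup (fun n => ∫⁻ ω, (Nn n ω).toMeasure I ∂(Pn n)) atTop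
        ≤ ∫⁻ ω, (N ω).toMeasure I ∂P)
    (K2 : ∀ (y : ℝ) (U : Set ℝ), IsFiniteUnionOfIntervals U →
      Tendsto (fun n => Pn n {ω | Yn n ω ≤ y ∧ (Nn n ω).toMeasure U = 0}) atTop
        (𝓝 (P {ω | Y ω ≤ y} * P {ω | (N ω).toMeasure U = 0}))) :
    TendstoInDistribution Nn atTop N Pn P ∧
      AsymptoticallyIndependent Pn P Yn Y Nn N := by
  have hUmeas : ∀ U, IsFiniteUnionOfIntervals U → MeasurableSet U := by
    rintro U ⟨S, hS, hSI, rfl⟩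
    exact MeasurableSet.sUnion hS.countable fun I hI => (hSI I hI).measurableSet
  have hYlim : ∀ y, Tendsto (fun n => Pn n {ω | Yn n ω ≤ y}) atTop (𝓝 (P {ω | Y ω ≤ y})) := by
    intro y
    -- `K2` for the empty union of intervals.
    have h := K2 y ∅ ⟨∅, Set.finite_empty, by simp, by simp⟩
    simpa using h
  have hmean : ∀ I : Set ℝ, I.OrdConnected →
      limsup (fun n => ∫⁻ μ, μ.toMeasure I ∂((Pn n).map (Nn n))) atTop
        ≤ ∫⁻ μ, μ.toMeasure I ∂(P.map N) := by
    intro I hI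
    have hm := PointMeasure.measurable_apply hI.measurableSet
    simp_rw [lintegral_map hm hN_meas, fun n => lintegral_map (μ := Pn n) hm (hNn_meas n)]
    exact K1 I hI
  have hav : PointMeasure.AvoidanceTendsto (fun n => (Pn n).map (Nn n)) (P.map N) := by
    intro U hU
    have hm := PointMeasure.measurableSet_measure_eq_zero (hUmeas U hU)
    simp_rw [Measure.map_apply hN_meas hm, fun n => Measure.map_apply (μ := Pn n) (hNn_meas n) hm]
    exact tendsto_measure_of_forall_tendsto_le hYn_meas hY_meas (measure_ne_top _ _) hYlim
      fun y => K2 y U hU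
  have hprob : ∀ n, IsProbabilityMeasure ((Pn n).map (Nn n)) := fun n =>
    Measure.isProbabilityMeasure_map (hNn_meas n).aemeasurable
  have hNlim : TendstoInDistribution Nn atTop N Pn P :=
    { forall_aemeasurable := fun n => (hNn_meas n).aemeasurable
      aemeasurable_limit := hN_meas.aemeasurable
      tendsto := tendsto_of_forall_isOpen_le_liminf' fun G hG =>
        PointMeasure.measure_le_liminf_of_isOpen hN_meas hN_simple hN_finite hmean hav hG }
  refine ⟨hNlim, hY, hNlim, fun y k B l hB => ?_⟩
  -- On `Yₙ ≤ y` the laws of `Nₙ` are sub-probability measures with limit `P(Y ≤ y) • law of N`.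
  have hQ_apply : ∀ {A : Set PointMeasure}, MeasurableSet A → ∀ n,
      (((Pn n).restrict {ω | Yn n ω ≤ y}).map (Nn n)) A
        = Pn n {ω | Yn n ω ≤ y ∧ Nn n ω ∈ A} := by
    intro A hA n
    rw [Measure.map_apply (hNn_meas n) hA, Measure.restrict_apply (hNn_meas n hA),
      Set.inter_comm]
    rfl
  have hQ : PointMeasure.AvoidanceTendsto
      (fun n => ((Pn n).restrict {ω | Yn n ω ≤ y}).map (Nn n))
      (P {ω | Y ω ≤ y} • P.map N) := by
    intro U hU
    have hm := PointMeasure.measurableSet_measure_eq_zero (hUmeas U hU)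
    simp_rw [hQ_apply hm, Measure.smul_apply, smul_eq_mul, Measure.map_apply hN_meas hm]
    exact K2 y U hU
  have hQP : P {ω | Y ω ≤ y} • P.map N ≤ P.map N := by
    refine Measure.le_iff.mpr fun A _ => ?_
    rw [Measure.smul_apply, smul_eq_mul]
    exact mul_le_of_le_one_left zero_le prob_le_one
  have hA : MeasurableSet {μ : PointMeasure | ∀ i, μ.toMeasure (B i) ≤ l i} := by
    rw [Set.ofPred_forall]
    exact MeasurableSet.iInter fun i =>
      PointMeasure.measurable_apply (hB i).1 measurableSet_Iic
  have h := PointMeasure.tendsto_measure_counts_le hN_meas hN_simple hN_finite hmean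
    (fun n => Measure.map_mono Measure.restrict_le_self (hNn_meas n)) hQP hav hQ hB l
  simp_rw [hQ_apply hA, Measure.smul_apply, smul_eq_mul, Measure.map_apply hN_meas hA] at h
  exact h
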